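/- Let $1\le r<N$ and $L\ge 1$ be integers, let $p_1,\dots,p_L\ge 0$ with $\sum_i p_i=1$, and let $\Sigma_1,\dots,\Sigma_L\in\mathbb{R}^{N\times N}$ be random positive semidefinite matrices whose images $\mathcal{R}_i=\mathrm{Im}(\Sigma_i)$ have dimension $r$ and are independent random points of the Grassmann manifold of $r$-dimensional subspaces of $\mathbb{R}^N$, each having a probability density with respect to the rotation-invariant probability measure on that manifold (the law of the span of $r$ independent standard Gaussian vectors). Write $\mathcal{N}_i=\mathrm{Null}(\Sigma_i)$. Given $\Sigma_1,\dots,\Sigma_L$, a matrix $\Phi\in\mathbb{R}^{M\times N}$ and $\sigma^2>0$, a class $C\in\{1,\dots,L\}$ is drawn with $\mathbb{P}[C=i]=p_i$, the signal $\mathbf{x}$ is $\mathcal{N}(0,\Sigma_i)$ conditionally on $C=i$, and $\mathbf{y}=\Phi\mathbf{x}+\mathbf{n}$ is observed, where $\mathbf{n}\sim\mathcal{N}(0,\sigma^2 I)$ is independent of $(C,\mathbf{x})$. Let $p(\mathbf{y}\mid C=i)$ be the conditional probability density of $\mathbf{y}$, let $\hat C(\mathbf{y})\in\arg\max_i\,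 p(\mathbf{y}\mid C=i)\,p_i$ be a (measurable) maximum a posteriori classifier, with ties broken in any way, and let $$P_e=\mathbb{P}[\hat C\ne C]=\sum_{i=1}^L p_i\,\mathbb{P}[\hat C\neq i\mid C=i].$$ Put $M=\min\{L-1,\,r+1\}$. Then: 1. With probability one over $(\Sigma_1,\dots,\Sigma_L)$, there is a matrix $\Phi\in\mathbb{R}^{M\times N}$ for which $\lim_{\sigma^2\to0}P_e=0$; that is, $M$ is an upper bound on the minimum number of designed measurements for which $\lim_{\sigma^2\to 0}P_e=0$. 2. For each $i$ let the columns of $\mathbf{N}_i\in\mathbb{R}^{N\times(N-r)}$ form a (possibly random) basis of $\mathcal{N}_i$, depending measurably on the underlying randomness and such that the pairs $(\mathcal{R}_i,\mathbf{N}_i)$, $i=1,\dots,L$, are independent (for instance, each $\mathbf{N}_i$ is a measurable function of $\mathcal{N}_i$ alone). Then, with probability one, for every permutation $\pi$ of $\{1,\dots,L\}$ and every matrix $\Phi\in\mathbb{R}^{M\times N}$ whose $M$ rows are obtained by picking one row from each of $\mathbf{N}_{\pi(1)}^T,\dots,\mathbf{N}_{\pi(M)}^T$, one has $\lim_{\sigma^2\to0}P_e=0$.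 -/

import Mathlib

open MeasureTheory ProbabilityTheory Filter Topology
open scoped ENNReal

noncomputable section

namespace SubspaceClassification

/-- `ℝⁿ` with its Euclidean structure. -/
abbrev Vec (n : ℕ) : Type := EuclideanSpace ℝ (Fin n)

/-! ### The Grassmann manifold and its invariant measure -/

/-- The set of `r`-dimensional linear subspaces of `ℝᴺ`. -/
def Grassmannian (N r : ℕ) : Type :=
  {W : Submodule ℝ (Vec N) // Module.finrank ℝ W = r}

/-- The orthogonal projection onto a point of the Grassmann manifold. -/
def Grassmannian.proj {N r : ℕ} (W : Grassmannian N r) : Vec N →L[ℝ] Vec N :=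
  W.1.starProjection

/-- The usual topology of the Grassmann manifold: that of the metric `‖P_V - P_W‖`, where `P_V` is
the orthogonal projection onto `V`. -/
instance (N r : ℕ) : TopologicalSpace (Grassmannian N r) :=
  TopologicalSpace.induced Grassmannian.proj inferInstance

instance (N r : ℕ) : MeasurableSpace (Grassmannian N r) := borel _

instance (N r : ℕ) : BorelSpace (Grassmannian N r) := ⟨rfl⟩

/-- The linearly independent `r`-tuples of vectors of `ℝᴺ`. -/
def Frame (N r : ℕ) : Type := {v : Fin r → Vec N // LinearIndependent ℝ v}

instance (N r : ℕ) : TopologicalSpace (Frame N r) :=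
  inferInstanceAs (TopologicalSpace {v : Fin r → Vec N // LinearIndependent ℝ v})

instance (N r : ℕ) : MeasurableSpace (Frame N r) :=
  inferInstanceAs (MeasurableSpace {v : Fin r → Vec N // LinearIndependent ℝ v})

instance (N r : ℕ) : BorelSpace (Frame N r) :=
  inferInstanceAs (BorelSpace {v : Fin r → Vec N // LinearIndependent ℝ v})

/-- The subspace spanned by a frame. -/
def Frame.span {N r : ℕ} (v : Frame N r) : Grassmannian N r :=
  ⟨Submodule.span ℝ (Set.range v.1), by
    simpa using finrank_span_eq_card v.2⟩

/-- The rotation-invariant (uniform) probability measure on the Grassmann manifold: the law of the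
span of `r` independent standard Gaussian vectors of `ℝᴺ`, for `r ≤ N`
(such vectors are linearly independent almost surely). -/
def uniformGrassmannian (N r : ℕ) : Measure (Grassmannian N r) :=
  (Measure.comap (Subtype.val : Frame N r → Fin r → Vec N)
    (Measure.pi fun _ : Fin r => stdGaussian (Vec N))).map Frame.span

/-- The projection onto the span of a frame, in terms of the inverse Gram matrix. -/
theorem Frame.proj_span_apply {N r : ℕ} (v : Frame N r) (x : Vec N) :
    v.span.proj x =
      ∑ i, ((Matrix.gram ℝ v.1)⁻¹.mulVec (fun j => inner ℝ (v.1 j) x)) i • v.1 i := by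
  have hdet : IsUnit (Matrix.gram ℝ v.1).det := by
    have := (Matrix.posDef_gram_of_linearIndependent (𝕜 := ℝ) v.2).det_pos
    exact (ne_of_gt this).isUnit
  refine Submodule.eq_starProjection_of_mem_of_inner_eq_zero (K := v.span.1) ?_ ?_
  · exact Submodule.sum_mem _ fun i _ =>
      Submodule.smul_mem _ _ (Submodule.subset_span ⟨i, rfl⟩)
  · intro w hw
    refine Submodule.span_induction (p := fun w _ => inner ℝ (x - _) w = 0) ?_ ?_ ?_ ?_ hw
    · rintro _ ⟨j, rfl⟩
      rw [real_inner_comm, inner_sub_right, inner_sum]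
      simp only [real_inner_smul_right]
      have h : (Matrix.gram ℝ v.1).mulVec
          ((Matrix.gram ℝ v.1)⁻¹.mulVec (fun j => inner ℝ (v.1 j) x)) j = inner ℝ (v.1 j) x := by
        rw [Matrix.mulVec_mulVec, Matrix.mul_nonsing_inv _ hdet, Matrix.one_mulVec]
      rw [← h]
      simp only [Matrix.mulVec, dotProduct, Matrix.gram_apply]
      rw [sub_eq_zero]
      exact Finset.sum_congr rfl fun i _ => mul_comm _ _
    · simp
    · intro a b _ _ ha hb
      rw [inner_add_right, ha, hb, add_zero]
    · intro c a _ ha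
      rw [inner_smul_right, ha, mul_zero]

/-- The span depends continuously on the frame. -/
theorem Frame.continuous_span {N r : ℕ} :
    Continuous (Frame.span : Frame N r → Grassmannian N r) := by
  rw [continuous_induced_rng, continuous_clm_apply]
  intro x
  have hv : Continuous (fun v : Frame N r => v.1) := continuous_subtype_val
  have hvi : ∀ i, Continuous (fun v : Frame N r => v.1 i) := fun i =>
    (continuous_apply i).comp hv
  have hg : Continuous (fun v : Frame N r => Matrix.gram ℝ v.1) :=
    continuous_matrix fun i j => by
      simpa [Matrix.gram_apply] using (hvi i).inner (hvi j)
  have hgi : Continuous (fun v : Frame N r => (Matrix.gram ℝ v.1)⁻¹) := by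
    simp only [Matrix.inv_def, Ring.inverse_eq_inv']
    refine Continuous.smul (hg.matrix_det.inv₀ fun v => ?_) hg.matrix_adjugate
    exact (Matrix.posDef_gram_of_linearIndependent (𝕜 := ℝ) v.2).det_pos.ne'
  have h : (fun v : Frame N r => v.span.proj x) = fun v =>
      ∑ i, ((Matrix.gram ℝ v.1)⁻¹.mulVec (fun j => inner ℝ (v.1 j) x)) i • v.1 i :=
    funext fun v => v.proj_span_apply x
  change Continuous (fun v : Frame N r => v.span.proj x)
  rw [h]
  refine continuous_finsetSum _ fun i _ => ?_
  have hc : Continuous (fun v : Frame N r =>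
      (Matrix.gram ℝ v.1)⁻¹.mulVec (fun j => inner ℝ (v.1 j) x) i) :=
    (continuous_apply i).comp
      (hgi.matrix_mulVec (continuous_pi fun j => (hvi j).inner continuous_const))
  exact hc.smul (hvi i)

/-- The frames form a measurable set of tuples. -/
theorem Frame.measurableEmbedding_val {N r : ℕ} :
    MeasurableEmbedding (Subtype.val : Frame N r → Fin r → Vec N) :=
  MeasurableEmbedding.subtype_coe (isOpen_setOfPred_linearIndependent (𝕜 := ℝ)).measurableSet

/-- Hence `uniformGrassmannian` is the push-forward along a measurable map. -/
theorem Frame.measurable_span {N r : ℕ} :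
    Measurable (Frame.span : Frame N r → Grassmannian N r) :=
  Frame.continuous_span.measurable

/-! ### The measurement model and the MAP classifier -/

/-- The image of a matrix, as a subspace of `ℝᴺ`. -/
abbrev image {N : ℕ} (S : Matrix (Fin N) (Fin N) ℝ) : Submodule ℝ (Vec N) :=
  LinearMap.range (Matrix.toEuclideanLin S)

/-- The null space of a matrix, as a subspace of `ℝᴺ`. -/
abbrev nullSpace {N : ℕ} (S : Matrix (Fin N) (Fin N) ℝ) : Submodule ℝ (Vec N) :=
  LinearMap.ker (Matrix.toEuclideanLin S)

variable {L M N : ℕ}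

/-- The law of the measurement `y = Φ x + n` when `x ∼ 𝒩(0, S)` and `n ∼ 𝒩(0, s I)` are
independent; `s` is the noise variance `σ²`. -/
def measurementLaw (Φ : Matrix (Fin M) (Fin N) ℝ) (s : ℝ) (S : Matrix (Fin N) (Fin N) ℝ) :
    Measure (Vec M) :=
  ((multivariateGaussian (0 : Vec N) S).prod
    (multivariateGaussian (0 : Vec M) (s • (1 : Matrix (Fin M) (Fin M) ℝ)))).map
      fun z => Matrix.toEuclideanLin Φ z.1 + z.2

/-- The probability density function of the measurement `y`, with respect to Lebesgue measure. -/
def measurementPDF (Φ : Matrix (Fin M) (Fin N) ℝ) (s : ℝ) (S : Matrix (Fin N) (Fin N) ℝ) :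
    Vec M → ℝ≥0∞ :=
  (measurementLaw Φ s S).rnDeriv volume

/-- `c` is a maximum a posteriori classifier for the classes `𝒩(0, S i)` with prior probabilities
`p i`: it picks, for (almost) every `y`, some `i` that maximizes `p(y | C = i) p i`. -/
def IsMAP (p : Fin L → ℝ) (S : Fin L → Matrix (Fin N) (Fin N) ℝ)
    (Φ : Matrix (Fin M) (Fin N) ℝ) (s : ℝ) (c : Vec M → Fin L) : Prop :=
  Measurable c ∧ ∀ᵐ y, ∀ j,
    measurementPDF Φ s (S j) y * ENNReal.ofReal (p j) ≤
      measurementPDF Φ s (S (c y)) y * ENNReal.ofReal (p (c y))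

/-- MAP classifiers exist. -/
theorem exists_isMAP [NeZero L] (p : Fin L → ℝ) (S : Fin L → Matrix (Fin N) (Fin N) ℝ)
    (Φ : Matrix (Fin M) (Fin N) ℝ) (s : ℝ) : ∃ c, IsMAP p S Φ s c := by
  classical
  set g : Fin L → Vec M → ℝ≥0∞ := fun i y =>
    measurementPDF Φ s (S i) y * ENNReal.ofReal (p i) with hgdef
  have hg : ∀ i, Measurable (g i) := fun i =>
    (Measure.measurable_rnDeriv _ _).mul_const _
  let A : Vec M → Finset (Fin L) := fun y => Finset.univ.filter fun i => ∀ j, g j y ≤ g i y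
  have hA : ∀ y, (A y).Nonempty := fun y => by
    obtain ⟨i, hi⟩ := Finite.exists_max (fun i => g i y)
    exact ⟨i, by simpa [A] using hi⟩
  have hAm : ∀ i, MeasurableSet {y | i ∈ A y} := fun i => by
    simp only [A, Finset.mem_filter, Finset.mem_univ, true_and, Set.ofPred_forall]
    exact MeasurableSet.iInter fun j => measurableSet_le (hg j) (hg i)
  refine ⟨fun y => (A y).min' (hA y), measurable_to_countable' fun i => ?_,
    Eventually.of_forall fun y j => ?_⟩
  · have : (fun y => (A y).min' (hA y)) ⁻¹' {i} =
        {y | i ∈ A y} ∩ ⋂ j, ⋂ (_ : j < i), {y | j ∈ A y}ᶜ := by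
      ext y
      simp only [Set.mem_preimage, Set.mem_singleton_iff, Set.mem_inter_iff, Set.mem_ofPred_eq,
        Set.mem_iInter, Set.mem_compl_iff]
      constructor
      · rintro rfl
        exact ⟨Finset.min'_mem _ _, fun j hj hjA => absurd (Finset.min'_le _ _ hjA) (not_le.2 hj)⟩
      · rintro ⟨h1, h2⟩
        refine le_antisymm (Finset.min'_le _ _ h1) ?_
        by_contra h
        exact h2 _ (not_le.1 h) (Finset.min'_mem _ _)
    rw [this]
    exact (hAm i).inter (MeasurableSet.iInter fun j => MeasurableSet.iInter fun _ => (hAm j).compl)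
  · have := Finset.min'_mem (A y) (hA y)
    simp only [A, Finset.mem_filter, Finset.mem_univ, true_and] at this
    exact this j

/-- The misclassification probability `P[c(y) ≠ C] = ∑ i, p i * P[c(y) ≠ i | C = i]`. -/
def misclassificationProb (p : Fin L → ℝ) (S : Fin L → Matrix (Fin N) (Fin N) ℝ)
    (Φ : Matrix (Fin M) (Fin N) ℝ) (s : ℝ) (c : Vec M → Fin L) : ℝ :=
  ∑ i, p i * (measurementLaw Φ s (S i)).real {y | c y ≠ i}

/-- The misclassification probability of MAP classification tends to `0` as `σ² = s` tends to `0`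
from above, however ties are broken in the MAP classifier. -/
def LowNoisePhaseTransition (p : Fin L → ℝ) (S : Fin L → Matrix (Fin N) (Fin N) ℝ)
    (Φ : Matrix (Fin M) (Fin N) ℝ) : Prop :=
  ∀ c : ℝ → Vec M → Fin L, (∀ s, 0 < s → IsMAP p S Φ s (c s)) →
    Tendsto (fun s => misclassificationProb p S Φ s (c s)) (𝓝[>] 0) (𝓝 0)

/-- The matrix whose `m`-th row is the `k m`-th vector of the basis `B (π m)`, for the first
`M ≤ L` values of the permutation `π`. -/
def oneVsAllMatrix {d : ℕ} (hM : M ≤ L) (B : Fin L → Fin d → Vec N) (π : Equiv.Perm (Fin L))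
    (k : Fin M → Fin d) : Matrix (Fin M) (Fin N) ℝ :=
  Matrix.of fun m j => B (π (Fin.castLE hM m)) (k m) j

end SubspaceClassification

end

noncomputable section

namespace SubspaceClassification

/-! ### Absolute continuity of the measurement laws -/

/-! The argument separates into a statistical half and a geometric half.

Statistics: suppose `w = Φᵀ c` is killed by one covariance `T` but not by another, `S`. Then `⟨c,
y⟩` is a centred Gaussian whose variance is `s ‖c‖²` under `T` but stays above a positive constant
under `S`, so thresholding `|⟨c, y⟩|` at a level between the two scales tests `S` against `T` with
vanishing errors (`exists_consistent_tests`). A MAP classifier confuses two classes no more than any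
test does (`IsMAP.confusion_le`), and a union bound over pairs finishes. One such direction per
unordered pair of classes is enough.

Geometry: a positive semidefinite matrix kills exactly the orthogonal complement of its image, so
for each pair the row space of `Φ` must contain a vector orthogonal to one image and not to the
other. There are two sources of such vectors. A row taken from the null space of class `i` is almost
surely not orthogonal to any other image; with `L - 1` such rows at most one class lacks its own
row, so every pair is served. Alternatively, `r + 1` independent rows span a space too large to
project injectively onto an `r`-dimensional image `V`, so some nonzero combination is orthogonal to
`V`, and an image independent of `V` and of the rows almost surely does not annihilate it
(`ae_distinguishes`).

Each almost sure claim concerns an image with a density that is independent of the other data. By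
Fubini and absolute continuity (`ae_of_indepFun_of_hasPDF`) it reduces to a uniform subspace against
fixed data, that is, to a span of Gaussian vectors. -/

theorem pi_absolutelyContinuous {n : ℕ} {α : Type*} [MeasurableSpace α] (μ ν : Measure α)
    [SigmaFinite μ] [SigmaFinite ν] (h : μ ≪ ν) :
    Measure.pi (fun _ : Fin n => μ) ≪ Measure.pi (fun _ : Fin n => ν) := by
  induction n with
  | zero => rw [Measure.pi_of_empty, Measure.pi_of_empty]
  | succ n ih =>
    have h1 := (measurePreserving_piFinSuccAbove (fun _ : Fin (n + 1) => μ) 0).symm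
    have h2 := (measurePreserving_piFinSuccAbove (fun _ : Fin (n + 1) => ν) 0).symm
    rw [← h1.map_eq, ← h2.map_eq]
    exact (h.prod ih).map h1.measurable

theorem stdGaussian_absolutelyContinuous (M : ℕ) :
    stdGaussian (Vec M) ≪ (volume : Measure (Vec M)) := by
  rw [← map_pi_eq_stdGaussian, ← (PiLp.volume_preserving_toLp (Fin M)).map_eq, volume_pi]
  exact (pi_absolutelyContinuous _ _ (gaussianReal_absolutelyContinuous 0 one_ne_zero)).map
    (PiLp.volume_preserving_toLp (Fin M)).measurable

open scoped MatrixOrder in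
theorem multivariateGaussian_smul_one (M : ℕ) {s : ℝ} (hs : 0 ≤ s) :
    multivariateGaussian (0 : Vec M) (s • (1 : Matrix (Fin M) (Fin M) ℝ)) =
      (stdGaussian (Vec M)).map fun x => √s • x := by
  have h : CFC.sqrt (s • (1 : Matrix (Fin M) (Fin M) ℝ)) = √s • 1 := by
    refine CFC.sqrt_unique ?_ ?_
    · rw [smul_mul_smul_comm, Real.mul_self_sqrt hs, one_mul]
    · exact (Matrix.PosSemidef.one.smul (Real.sqrt_nonneg s)).nonneg
  rw [multivariateGaussian, h]
  simp

theorem multivariateGaussian_smul_one_absolutelyContinuous (M : ℕ) {s : ℝ} (hs : 0 < s) :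
    multivariateGaussian (0 : Vec M) (s • (1 : Matrix (Fin M) (Fin M) ℝ)) ≪ volume := by
  rw [multivariateGaussian_smul_one M hs.le]
  refine ((stdGaussian_absolutelyContinuous M).map (measurable_const_smul _)).trans ?_
  rw [Measure.map_addHaar_smul _ (Real.sqrt_pos.2 hs).ne']
  exact Measure.smul_absolutelyContinuous

variable {L M N : ℕ}

instance isProbabilityMeasure_measurementLaw (Φ : Matrix (Fin M) (Fin N) ℝ) (s : ℝ)
    (S : Matrix (Fin N) (Fin N) ℝ) : IsProbabilityMeasure (measurementLaw Φ s S) :=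
  Measure.isProbabilityMeasure_map (by fun_prop)

/-- The noise law has a density, and convolving with it gives one to the law of `Φ x + n` however
singular `S` and `Φ` are. Hence `measurementPDF` integrates back to `measurementLaw`. -/
theorem measurementLaw_absolutelyContinuous (Φ : Matrix (Fin M) (Fin N) ℝ) {s : ℝ} (hs : 0 < s)
    (S : Matrix (Fin N) (Fin N) ℝ) : measurementLaw Φ s S ≪ volume := by
  have hΦ : Measurable (Matrix.toEuclideanLin Φ) :=
    (LinearMap.continuous_of_finiteDimensional _).measurable
  have h : measurementLaw Φ s S =
      ((multivariateGaussian (0 : Vec N) S).map (Matrix.toEuclideanLin Φ)) ∗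
        (multivariateGaussian (0 : Vec M) (s • (1 : Matrix (Fin M) (Fin M) ℝ))) := by
    rw [Measure.conv, ← Measure.map_id (μ := multivariateGaussian (0 : Vec M) _),
      Measure.map_prod_map _ _ hΦ measurable_id, Measure.map_map (by fun_prop) (by fun_prop)]
    rfl
  rw [h]
  exact Measure.conv_absolutelyContinuous (multivariateGaussian_smul_one_absolutelyContinuous M hs)

/-! ### One-dimensional marginals of the measurement laws -/

theorem map_inner_multivariateGaussian {S : Matrix (Fin N) (Fin N) ℝ} (hS : S.PosSemidef)
    (w : Vec N) :
    (multivariateGaussian (0 : Vec N) S).map (fun x => inner ℝ w x) =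
      gaussianReal 0 (w.ofLp ⬝ᵥ S.mulVec w.ofLp).toNNReal := by
  have h := IsGaussian.map_eq_gaussianReal (μ := multivariateGaussian (0 : Vec N) S)
    (innerSL ℝ w)
  rw [ContinuousLinearMap.integral_comp_id_comm IsGaussian.integrable_id,
    integral_id_multivariateGaussian, map_zero] at h
  rw [← covarianceBilin_multivariateGaussian (μ := 0) hS, covarianceBilin_self
    IsGaussian.memLp_two_id]
  exact h

/-- With `w = Φᵀ c` one has `⟨c, y⟩ = ⟨w, x⟩ + ⟨c, n⟩`, a sum of independent centred Gaussians, so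
the variances add. -/
theorem map_inner_measurementLaw (Φ : Matrix (Fin M) (Fin N) ℝ) {s : ℝ} (hs : 0 ≤ s)
    {S : Matrix (Fin N) (Fin N) ℝ} (hS : S.PosSemidef) (c : Vec M) :
    (measurementLaw Φ s S).map (fun y => inner ℝ c y) =
      gaussianReal 0 (((Matrix.toEuclideanLin Φ.transpose c).ofLp ⬝ᵥ
        S.mulVec (Matrix.toEuclideanLin Φ.transpose c).ofLp).toNNReal +
          (s * ‖c‖ ^ 2).toNNReal) := by
  set w := Matrix.toEuclideanLin Φ.transpose c with hw
  have hΦ : Measurable (Matrix.toEuclideanLin Φ) :=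
    (LinearMap.continuous_of_finiteDimensional _).measurable
  have hadj : ∀ x : Vec N, inner ℝ c (Matrix.toEuclideanLin Φ x) = inner ℝ w x := by
    intro x
    rw [hw, ← Matrix.conjTranspose_eq_transpose_of_trivial,
      Matrix.toEuclideanLin_conjTranspose_eq_adjoint, LinearMap.adjoint_inner_left]
  have hone : (s • (1 : Matrix (Fin M) (Fin M) ℝ)).PosSemidef := Matrix.PosSemidef.one.smul hs
  rw [measurementLaw, Measure.map_map (by fun_prop) (by fun_prop)]
  have hsum : ((fun y => inner ℝ c y) ∘ fun z : Vec N × Vec M => Matrix.toEuclideanLin Φ z.1 + z.2)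
      = (fun z => inner ℝ w z.1) + fun z => inner ℝ c z.2 := by
    ext z
    simp [inner_add_right, hadj]
  rw [hsum]
  have key := gaussianReal_add_gaussianReal_of_indepFun
    (P := (multivariateGaussian (0 : Vec N) S).prod
      (multivariateGaussian (0 : Vec M) (s • (1 : Matrix (Fin M) (Fin M) ℝ))))
    (X := fun z => inner ℝ w z.1) (Y := fun z => inner ℝ c z.2)
    (m₁ := 0) (m₂ := 0) (v₁ := (w.ofLp ⬝ᵥ S.mulVec w.ofLp).toNNReal)
    (v₂ := (s * ‖c‖ ^ 2).toNNReal)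
    (indepFun_prod (X := fun x => inner ℝ w x) (Y := fun y => inner ℝ c y)
      (by fun_prop) (by fun_prop)) ?_ ?_
  · simpa using key
  · rw [← map_inner_multivariateGaussian hS]
    change Measure.map ((fun x => inner ℝ w x) ∘ Prod.fst) _ = _
    rw [← Measure.map_map (by fun_prop) (by fun_prop), Measure.map_fst_prod]
    simp
  · have hv : s * ‖c‖ ^ 2 = c.ofLp ⬝ᵥ (s • (1 : Matrix (Fin M) (Fin M) ℝ)).mulVec c.ofLp := by
      rw [EuclideanSpace.real_norm_sq_eq, Matrix.smul_mulVec, Matrix.one_mulVec, dotProduct_smul]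
      simp [dotProduct, pow_two]
    rw [hv, ← map_inner_multivariateGaussian hone]
    change Measure.map ((fun x => inner ℝ c x) ∘ Prod.snd) _ = _
    rw [← Measure.map_map (by fun_prop) (by fun_prop), Measure.map_snd_prod]
    simp

/-! ### Tests between two centred Gaussian laws -/

/-- Chebyshev's inequality. -/
theorem gaussianReal_abs_gt_le (v : NNReal) {ε : ℝ} (hε : 0 < ε) :
    (gaussianReal 0 v).real {x | ε < |x|} ≤ v / ε ^ 2 := by
  have h := meas_ge_le_variance_div_sq (memLp_id_gaussianReal' (μ := 0) (v := v) 2 (by simp)) hε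
  simp only [id, integral_id_gaussianReal, sub_zero] at h
  have hv : Var[fun x => x; gaussianReal 0 v] = v := variance_fun_id_gaussianReal
  refine ENNReal.toReal_le_of_le_ofReal (by positivity) ?_
  refine (measure_mono fun x hx => ?_).trans (h.trans (le_of_eq ?_))
  · have hx' : ε < |x| := by simpa using hx
    exact hx'.le
  · change ENNReal.ofReal (Var[fun x => x; gaussianReal 0 v] / ε ^ 2) = _
    rw [hv]

/-- The density is at most `1 / √(2πv) ≤ 1 / √v`, and the interval has length `2ε`. -/
theorem gaussianReal_abs_le_le {v : NNReal} (hv : v ≠ 0) {ε : ℝ} (hε : 0 ≤ ε) :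
    (gaussianReal 0 v).real {x | |x| ≤ ε} ≤ (√v)⁻¹ * (2 * ε) := by
  have hv' : 0 < (v : ℝ) := by positivity
  refine ENNReal.toReal_le_of_le_ofReal (by positivity) ?_
  rw [gaussianReal_apply _ hv]
  have hb : ∀ x, gaussianPDF 0 v x ≤ ENNReal.ofReal (√v)⁻¹ := by
    intro x
    refine ENNReal.ofReal_le_ofReal ?_
    rw [gaussianPDFReal]
    have h1 : (√(2 * Real.pi * v))⁻¹ ≤ (√(v : ℝ))⁻¹ := by
      gcongr
      nlinarith [Real.pi_gt_three]
    have h2 : Real.exp (-(x - 0) ^ 2 / (2 * v)) ≤ 1 :=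
      Real.exp_le_one_iff.2 (div_nonpos_of_nonpos_of_nonneg (by nlinarith [sq_nonneg (x - 0)])
        (by positivity))
    calc _ ≤ (√(v : ℝ))⁻¹ * 1 := by gcongr
      _ = _ := mul_one _
  have hset : {x : ℝ | |x| ≤ ε} = Set.Icc (-ε) ε := by ext x; simp [abs_le]
  calc _ ≤ ∫⁻ _ in {x : ℝ | |x| ≤ ε}, ENNReal.ofReal (√v)⁻¹ := lintegral_mono fun x => hb x
    _ = _ := by
      rw [setLIntegral_const, hset, Real.volume_Icc, ← ENNReal.ofReal_mul (by positivity)]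
      congr 2
      ring

/-! ### The pairwise error of a MAP classifier -/

/-- The probability that a MAP classifier confuses `i` with `j` is at most the total error of any
test between the two classes. -/
theorem IsMAP.confusion_le {p : Fin L → ℝ} (hp : ∀ i, 0 ≤ p i)
    {S : Fin L → Matrix (Fin N) (Fin N) ℝ} {Φ : Matrix (Fin M) (Fin N) ℝ} {s : ℝ} (hs : 0 < s)
    {c : Vec M → Fin L} (hc : IsMAP p S Φ s c) (i j : Fin L) {A : Set (Vec M)}
    (hA : MeasurableSet A) :
    p i * (measurementLaw Φ s (S i)).real {y | c y = j} ≤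
      p i * (measurementLaw Φ s (S i)).real A + p j * (measurementLaw Φ s (S j)).real Aᶜ := by
  have hlaw : ∀ (k : Fin L) {T : Set (Vec M)}, MeasurableSet T →
      ENNReal.ofReal (p k * (measurementLaw Φ s (S k)).real T) =
        ∫⁻ y in T, measurementPDF Φ s (S k) y * ENNReal.ofReal (p k) := by
    intro k T hT
    simp only [measurementPDF]
    rw [lintegral_mul_const _ (Measure.measurable_rnDeriv _ _),
      Measure.setLIntegral_rnDeriv (measurementLaw_absolutelyContinuous Φ hs (S k)),
      mul_comm, ENNReal.ofReal_mul measureReal_nonneg, ofReal_measureReal]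
  have hj : MeasurableSet {y | c y = j} := hc.1 (measurableSet_singleton j)
  rw [← ENNReal.ofReal_le_ofReal_iff (by have := hp i; have := hp j; positivity),
    ENNReal.ofReal_add (mul_nonneg (hp i) measureReal_nonneg)
      (mul_nonneg (hp j) measureReal_nonneg), hlaw i hj, hlaw i hA, hlaw j hA.compl,
    ← lintegral_inter_add_sdiff _ _ hA]
  -- Inside `A` the event is simply enlarged to `A`. Outside `A`, where the classifier answers `j`,
  -- the MAP inequality replaces the weighted density of `i` by that of `j`.
  gcongr ?_ + ?_
  · exact lintegral_mono_set Set.inter_subset_right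
  · calc _ ≤ ∫⁻ y in {y | c y = j} \ A, measurementPDF Φ s (S j) y * ENNReal.ofReal (p j) := by
          refine lintegral_mono_ae ?_
          filter_upwards [ae_restrict_of_ae hc.2, ae_restrict_mem (hj.diff hA)] with y hy hyj
          have h := hy i
          rwa [show c y = j from hyj.1] at h
      _ ≤ _ := lintegral_mono_set fun y hy => hy.2

/-- A direction in which one class has no signal and the other has some yields tests whose errors
vanish with the noise. -/
theorem exists_consistent_tests (Φ : Matrix (Fin M) (Fin N) ℝ) {S T : Matrix (Fin N) (Fin N) ℝ}
    (hS : S.PosSemidef) (hT : T.PosSemidef) (c : Vec M)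
    (hST : Matrix.toEuclideanLin S (Matrix.toEuclideanLin Φ.transpose c) ≠ 0)
    (hTT : Matrix.toEuclideanLin T (Matrix.toEuclideanLin Φ.transpose c) = 0) :
    ∃ A : ℝ → Set (Vec M), (∀ s, MeasurableSet (A s)) ∧
      Tendsto (fun s => (measurementLaw Φ s S).real (A s)) (𝓝[>] 0) (𝓝 0) ∧
      Tendsto (fun s => (measurementLaw Φ s T).real (A s)ᶜ) (𝓝[>] 0) (𝓝 0) := by
  set w := Matrix.toEuclideanLin Φ.transpose c with hw
  have hTw : T.mulVec w.ofLp = 0 := by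
    have := congrArg WithLp.ofLp hTT
    simpa [Matrix.toLpLin_apply] using this
  have hSw : 0 < w.ofLp ⬝ᵥ S.mulVec w.ofLp := by
    refine lt_of_le_of_ne (by simpa using hS.dotProduct_mulVec_nonneg w.ofLp) fun h => hST ?_
    have := (hS.dotProduct_mulVec_zero_iff w.ofLp).1 (by simpa using h.symm)
    rw [Matrix.toLpLin_apply, this]
    rfl
  set v := w.ofLp ⬝ᵥ S.mulVec w.ofLp
  have hm : Measurable fun y : Vec M => inner ℝ c y := by fun_prop
  have hmA : ∀ s : ℝ, MeasurableSet {x : ℝ | |x| ≤ √√s} := fun s =>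
    measurableSet_le (by fun_prop) (by fun_prop)
  have hsqrt : Tendsto (fun s : ℝ => √√s) (𝓝[>] 0) (𝓝 0) := by
    have : Continuous fun s : ℝ => √√s := by fun_prop
    simpa using (this.tendsto 0).mono_left nhdsWithin_le_nhds
  -- The threshold `s^(1/4)` tends to `0`, so the class `S` rarely falls below it, yet it dominates
  -- the noise scale `s^(1/2)`: Chebyshev bounds the other error by `s ‖c‖² / √s = √s ‖c‖²`.
  refine ⟨fun s => (fun y => inner ℝ c y) ⁻¹' {x | |x| ≤ √√s}, fun s => hm (hmA s), ?_, ?_⟩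
  · refine tendsto_of_tendsto_of_tendsto_of_le_of_le' tendsto_const_nhds
      (h := fun s => (√v)⁻¹ * (2 * √√s)) ?_ (Eventually.of_forall fun _ => measureReal_nonneg) ?_
    · simpa using (hsqrt.const_mul 2).const_mul (√v)⁻¹
    · filter_upwards [self_mem_nhdsWithin] with s hs
      have hs' : (0 : ℝ) < s := hs
      rw [← map_measureReal_apply hm (hmA s), map_inner_measurementLaw Φ hs'.le hS]
      have hpos : 0 < v.toNNReal := Real.toNNReal_pos.2 hSw
      refine (gaussianReal_abs_le_le (by positivity) (Real.sqrt_nonneg _)).trans ?_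
      gcongr
      rw [NNReal.coe_add, Real.coe_toNNReal _ hSw.le]
      exact le_add_of_nonneg_right (NNReal.coe_nonneg _)
  · refine tendsto_of_tendsto_of_tendsto_of_le_of_le' tendsto_const_nhds
      (h := fun s => √s * ‖c‖ ^ 2) ?_ (Eventually.of_forall fun _ => measureReal_nonneg) ?_
    · have : Continuous fun s : ℝ => √s * ‖c‖ ^ 2 := by fun_prop
      simpa using (this.tendsto 0).mono_left nhdsWithin_le_nhds
    · filter_upwards [self_mem_nhdsWithin] with s hs
      have hs' : (0 : ℝ) < s := hs
      rw [← Set.preimage_compl, ← map_measureReal_apply hm (hmA s).compl,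
        map_inner_measurementLaw Φ hs'.le hT, ← hw, hTw]
      have hset : {x : ℝ | |x| ≤ √√s}ᶜ = {x | √√s < |x|} := by ext; simp
      rw [hset]
      refine (gaussianReal_abs_gt_le _ (by positivity)).trans (le_of_eq ?_)
      have hsc : 0 ≤ s * ‖c‖ ^ 2 := by positivity
      rw [Real.sq_sqrt (Real.sqrt_nonneg s), dotProduct_zero, Real.toNNReal_zero, zero_add,
        Real.coe_toNNReal _ hsc]
      rw [div_eq_iff (by positivity)]
      nth_rewrite 1 [← Real.mul_self_sqrt hs'.le]
      ring

/-- `c` is a direction of the measurement space in which the class with covariance `T` has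
no signal and the class with covariance `S` has some. -/
def Separates (Φ : Matrix (Fin M) (Fin N) ℝ) (S T : Matrix (Fin N) (Fin N) ℝ) (c : Vec M) :
    Prop :=
  Matrix.toEuclideanLin S (Matrix.toEuclideanLin Φ.transpose c) ≠ 0 ∧
    Matrix.toEuclideanLin T (Matrix.toEuclideanLin Φ.transpose c) = 0

theorem lowNoisePhaseTransition_of_separates {p : Fin L → ℝ} (hp : p ∈ stdSimplex ℝ (Fin L))
    {S : Fin L → Matrix (Fin N) (Fin N) ℝ} (hS : ∀ i, (S i).PosSemidef)
    {Φ : Matrix (Fin M) (Fin N) ℝ}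
    (h : ∀ i j, i ≠ j → (∃ c, Separates Φ (S i) (S j) c) ∨ ∃ c, Separates Φ (S j) (S i) c) :
    LowNoisePhaseTransition p S Φ := by
  intro c hc
  have hconf : ∀ i j, i ≠ j →
      Tendsto (fun s => p i * (measurementLaw Φ s (S i)).real {y | c s y = j}) (𝓝[>] 0) (𝓝 0) := by
    intro i j hij
    obtain ⟨A, hA, hAi, hAj⟩ : ∃ A : ℝ → Set (Vec M), (∀ s, MeasurableSet (A s)) ∧
        Tendsto (fun s => (measurementLaw Φ s (S i)).real (A s)) (𝓝[>] 0) (𝓝 0) ∧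
        Tendsto (fun s => (measurementLaw Φ s (S j)).real (A s)ᶜ) (𝓝[>] 0) (𝓝 0) := by
      rcases h i j hij with ⟨d, hd⟩ | ⟨d, hd⟩
      · exact exists_consistent_tests Φ (hS i) (hS j) d hd.1 hd.2
      · obtain ⟨A, hA, hAj, hAi⟩ := exists_consistent_tests Φ (hS j) (hS i) d hd.1 hd.2
        -- Complementing a test exchanges the roles of the two classes, so the order in which a
        -- direction separates the pair is immaterial.
        exact ⟨fun s => (A s)ᶜ, fun s => (hA s).compl, hAi, by simpa using hAj⟩
    refine tendsto_of_tendsto_of_tendsto_of_le_of_le' tendsto_const_nhds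
      (h := fun s => p i * (measurementLaw Φ s (S i)).real (A s) +
        p j * (measurementLaw Φ s (S j)).real (A s)ᶜ) ?_
      (Eventually.of_forall fun _ => mul_nonneg (hp.1 i) measureReal_nonneg) ?_
    · simpa using (hAi.const_mul (p i)).add (hAj.const_mul (p j))
    · filter_upwards [self_mem_nhdsWithin] with s hs
      exact (hc s hs).confusion_le hp.1 hs i j (hA s)
  have hsum : Tendsto (fun s => ∑ i, ∑ j ∈ Finset.univ.erase i,
      p i * (measurementLaw Φ s (S i)).real {y | c s y = j}) (𝓝[>] 0) (𝓝 0) := by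
    have := tendsto_finsetSum (Finset.univ : Finset (Fin L)) fun i _ =>
      tendsto_finsetSum (Finset.univ.erase i) fun j hj =>
        hconf i j (Finset.ne_of_mem_erase hj).symm
    simpa using this
  refine squeeze_zero (fun s => Finset.sum_nonneg fun i _ =>
    mul_nonneg (hp.1 i) measureReal_nonneg) (fun s => ?_) hsum
  refine Finset.sum_le_sum fun i _ => ?_
  rw [← Finset.mul_sum]
  refine mul_le_mul_of_nonneg_left ?_ (hp.1 i)
  refine (measureReal_mono (fun y hy => ?_) (measure_ne_top _ _)).trans
    (measureReal_biUnion_finset_le (Finset.univ.erase i) fun j => {y | c s y = j})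
  exact Set.mem_biUnion (Finset.mem_coe.2 (Finset.mem_erase.2 ⟨hy, Finset.mem_univ _⟩)) rfl

variable {r : ℕ}

/-! ### Topology and measurability on the Grassmann manifold -/

theorem Grassmannian.isInducing_proj :
    IsInducing (Grassmannian.proj : Grassmannian N r → Vec N →L[ℝ] Vec N) := ⟨rfl⟩

instance : SecondCountableTopology (Grassmannian N r) :=
  Grassmannian.isInducing_proj.secondCountableTopology

theorem Grassmannian.proj_eq_zero_iff (W : Grassmannian N r) (v : Vec N) :
    W.proj v = 0 ↔ v ∈ W.1ᗮ :=
  Submodule.starProjection_apply_eq_zero_iff _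

theorem isClosed_exists_mem_isCompact {C X : Type*} [TopologicalSpace C] [TopologicalSpace X]
    {K : Set C} (hK : IsCompact K) {F : Set (C × X)} (hF : IsClosed F) :
    IsClosed {x | ∃ c ∈ K, (c, x) ∈ F} := by
  have : CompactSpace K := isCompact_iff_compactSpace.1 hK
  have h : IsClosed ((fun z : K × X => ((z.1 : C), z.2)) ⁻¹' F) := hF.preimage (by fun_prop)
  convert isClosedMap_snd_of_compactSpace _ h using 1
  ext x
  simp

/-- Existential conditions `f c x = 0 ∧ g c x ≠ 0` over a finite-dimensional parameter `c` are
measurable. -/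
theorem measurableSet_exists_eq_zero_and_ne_zero {C X E F : Type*} [NormedAddCommGroup C]
    [ProperSpace C] [TopologicalSpace X] [MeasurableSpace X] [OpensMeasurableSpace X]
    [NormedAddCommGroup E] [NormedAddCommGroup F] {f : C × X → E} {g : C × X → F}
    (hf : Continuous f) (hg : Continuous g) :
    MeasurableSet {x | ∃ c, f (c, x) = 0 ∧ g (c, x) ≠ 0} := by
  -- Exhaustion by compact parameter sets and closed conditions: bounding `‖c‖` by `k` and `‖g‖`
  -- below by `1 / (k + 1)` makes each piece the projection of a closed set along a compact factor,
  -- hence closed.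
  have h : {x | ∃ c, f (c, x) = 0 ∧ g (c, x) ≠ 0} = ⋃ k : ℕ,
      {x | ∃ c ∈ Metric.closedBall (0 : C) k,
        (c, x) ∈ {z | f z = 0} ∩ {z | 1 / ((k : ℝ) + 1) ≤ ‖g z‖}} := by
    ext x
    simp only [Set.mem_ofPred_eq, Set.mem_iUnion, Set.mem_inter_iff, mem_closedBall_zero_iff]
    constructor
    · rintro ⟨c, hfc, hgc⟩
      obtain ⟨a, ha⟩ := exists_nat_ge ‖c‖
      obtain ⟨b, hb⟩ := exists_nat_one_div_lt (norm_pos_iff.2 hgc)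
      refine ⟨max a b, c, ha.trans (by exact_mod_cast le_max_left a b), hfc, ?_⟩
      refine le_trans ?_ hb.le
      have : (b : ℝ) ≤ (max a b : ℕ) := by exact_mod_cast le_max_right a b
      gcongr
    · rintro ⟨k, c, -, hfc, hgc⟩
      exact ⟨c, hfc, norm_pos_iff.1 (lt_of_lt_of_le (by positivity) hgc)⟩
  rw [h]
  refine MeasurableSet.iUnion fun k => IsClosed.measurableSet ?_
  exact isClosed_exists_mem_isCompact (isCompact_closedBall _ _)
    ((isClosed_eq hf continuous_const).inter (isClosed_le continuous_const hg.norm))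

theorem continuous_proj_apply {X : Type*} [TopologicalSpace X] {W : X → Grassmannian N r}
    {v : X → Vec N} (hW : Continuous W) (hv : Continuous v) :
    Continuous fun x => (W x).proj (v x) :=
  (Grassmannian.isInducing_proj.continuous.comp hW).clm_apply hv

/-- The subspace spanned by the vectors `w j`, and even its parametrization by coordinates, is
mapped injectively by the projection onto `W`. -/
def Transversal {m : ℕ} (w : Fin m → Vec N) (W : Grassmannian N r) : Prop :=
  ∀ c : Vec m, W.proj (∑ j, c j • w j) = 0 → c = 0

theorem measurableSet_transversal {m : ℕ} :
    MeasurableSet {z : (Fin m → Vec N) × Grassmannian N r | Transversal z.1 z.2} := by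
  have h := measurableSet_exists_eq_zero_and_ne_zero (C := Vec m)
    (X := (Fin m → Vec N) × Grassmannian N r)
    (f := fun z => z.2.2.proj (∑ j, z.1 j • z.2.1 j)) (g := fun z => z.1)
    (continuous_proj_apply (by fun_prop) (by fun_prop)) (by fun_prop)
  convert h.compl using 1
  ext z
  simp [Transversal]

/-- Some combination of the vectors `w j` is orthogonal to `V` but not to `W`. -/
def Distinguishes {m : ℕ} (w : Fin m → Vec N) (V W : Grassmannian N r) : Prop :=
  ∃ c : Vec m, V.proj (∑ j, c j • w j) = 0 ∧ W.proj (∑ j, c j • w j) ≠ 0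

theorem measurableSet_distinguishes {m : ℕ} :
    MeasurableSet {z : ((Fin m → Vec N) × Grassmannian N r) × Grassmannian N r |
      Distinguishes z.1.1 z.1.2 z.2} :=
  measurableSet_exists_eq_zero_and_ne_zero (C := Vec m)
    (X := ((Fin m → Vec N) × Grassmannian N r) × Grassmannian N r)
    (f := fun z => z.2.1.2.proj (∑ j, z.1 j • z.2.1.1 j))
    (g := fun z => z.2.2.proj (∑ j, z.1 j • z.2.1.1 j))
    (continuous_proj_apply (by fun_prop) (by fun_prop))
    (continuous_proj_apply (by fun_prop) (by fun_prop))

/-! ### Independent Gaussian vectors are in general position -/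

theorem ae_inner_stdGaussian_ne_zero {v : Vec N} (hv : v ≠ 0) :
    ∀ᵐ g ∂stdGaussian (Vec N), inner ℝ v g ≠ 0 := by
  have h := map_inner_multivariateGaussian (N := N) Matrix.PosSemidef.one v
  rw [multivariateGaussian_zero_one, Matrix.one_mulVec] at h
  have hpos : v.ofLp ⬝ᵥ v.ofLp ≠ 0 := by
    rw [Ne, dotProduct_self_eq_zero]
    exact fun h0 => hv (by ext i; simp [h0])
  have hnn : 0 ≤ v.ofLp ⬝ᵥ v.ofLp := Finset.sum_nonneg fun i _ => mul_self_nonneg _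
  have := nullSingletonClass_gaussianReal (μ := 0)
    (Real.toNNReal_pos.2 (lt_of_le_of_ne hnn hpos.symm)).ne'
  have h0 : ∀ᵐ x ∂((stdGaussian (Vec N)).map fun g => inner ℝ v g), x ≠ 0 := by
    rw [h]
    exact Measure.ae_ne _ 0
  exact ae_of_ae_map (f := fun g => inner ℝ v g) (p := fun x => x ≠ 0) (by fun_prop) h0

theorem ae_notMem_stdGaussian {U : Submodule ℝ (Vec N)} (hU : U ≠ ⊤) :
    ∀ᵐ g ∂stdGaussian (Vec N), g ∉ U := by
  obtain ⟨v, hv, hv0⟩ := (Submodule.ne_bot_iff _).1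
    (mt (Submodule.orthogonal_eq_bot_iff (K := U)).1 hU)
  filter_upwards [ae_inner_stdGaussian_ne_zero hv0] with g hg hgU
  exact hg (Submodule.inner_left_of_mem_orthogonal hgU hv)

/-- Fewer than `m` vectors span a proper subspace of `ℝᵐ`, whose preimage under the surjection `A`
is proper; the next independent Gaussian vector almost surely avoids it. -/
theorem ae_linearIndependent_comp {m : ℕ} (A : Vec N →ₗ[ℝ] (Fin m → ℝ))
    (hA : Function.Surjective A) {k : ℕ} (hk : k ≤ m) :
    ∀ᵐ g ∂Measure.pi (fun _ : Fin k => stdGaussian (Vec N)),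
      LinearIndependent ℝ fun i => A (g i) := by
  have hAc : Continuous A := A.continuous_of_finiteDimensional
  induction k with
  | zero => exact Eventually.of_forall fun g => linearIndependent_empty_type
  | succ k ih =>
    have hmp := measurePreserving_piFinSuccAbove (fun _ : Fin (k + 1) => stdGaussian (Vec N)) 0
    have hms : MeasurableSet {z : Vec N × (Fin k → Vec N) |
        LinearIndependent ℝ (Fin.cons (A z.1) fun i => A (z.2 i) : Fin (k + 1) → Fin m → ℝ)} := by
      refine (isOpen_setOfPred_linearIndependent (𝕜 := ℝ)).measurableSet.preimage
        (Continuous.measurable ?_)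
      refine continuous_pi fun i => ?_
      refine Fin.cases ?_ (fun i => ?_) i
      · simpa [Function.comp_def] using hAc.comp continuous_fst
      · simpa [Function.comp_def] using hAc.comp ((continuous_apply i).comp continuous_snd)
    have hae : ∀ᵐ z ∂(stdGaussian (Vec N)).prod (Measure.pi fun _ : Fin k => stdGaussian (Vec N)),
        z ∈ {z : Vec N × (Fin k → Vec N) | LinearIndependent ℝ
          (Fin.cons (A z.1) fun i => A (z.2 i) : Fin (k + 1) → Fin m → ℝ)} := by
      rw [Measure.ae_prod_mem_iff_ae_ae_mem hms, Measure.ae_ae_comm hms]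
      filter_upwards [ih (by omega)] with g hg
      have hU : (Submodule.span ℝ (Set.range fun i => A (g i))).comap A ≠ ⊤ := by
        intro h
        have htop : Submodule.span ℝ (Set.range fun i => A (g i)) = ⊤ := by
          rw [eq_top_iff]
          intro x _
          obtain ⟨y, rfl⟩ := hA x
          exact (h ▸ Submodule.mem_top : y ∈ Submodule.comap A _)
        have h1 := finrank_span_eq_card hg
        rw [htop, finrank_top, Module.finrank_fin_fun, Fintype.card_fin] at h1
        omega
      filter_upwards [ae_notMem_stdGaussian hU] with x hx
      exact linearIndependent_finCons.2 ⟨hg, hx⟩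
    have := hmp.quasiMeasurePreserving.ae hae
    filter_upwards [this] with g hg
    convert hg using 1
    ext i
    refine Fin.cases ?_ (fun i => ?_) i
    · simp
    · simp [Fin.tail]

/-- Almost sure properties of a uniformly distributed subspace can be checked on the span of
independent Gaussian vectors. -/
theorem ae_uniformGrassmannian {P : Grassmannian N r → Prop} (hP : MeasurableSet {W | P W})
    (h : ∀ᵐ g ∂Measure.pi (fun _ : Fin r => stdGaussian (Vec N)),
      ∀ hg : LinearIndependent ℝ g, P (Frame.span ⟨g, hg⟩)) :
    ∀ᵐ W ∂uniformGrassmannian N r, P W := by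
  refine (ae_map_iff Frame.measurable_span.aemeasurable hP).2 ?_
  refine (Frame.measurableEmbedding_val.comap_apply _ _).trans ?_
  refine measure_mono_null ?_ h
  rintro _ ⟨v, hv, rfl⟩ h0
  exact hv (h0 v.2)

/-- If `∑ c j • w j` is orthogonal to the Gaussian vectors `g i`, then `c` is orthogonal to every `A
(g i) = (⟨w j, g i⟩)_j`. These `r` vectors almost surely span `ℝʳ`, so `c = 0`. -/
theorem ae_transversal_of_eq {w : Fin r → Vec N} (hw : LinearIndependent ℝ w) :
    ∀ᵐ W ∂uniformGrassmannian N r, Transversal w W := by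
  have hmeas : MeasurableSet {W : Grassmannian N r | Transversal w W} :=
    measurable_prodMk_left (x := w) measurableSet_transversal
  refine ae_uniformGrassmannian hmeas ?_
  let A : Vec N →ₗ[ℝ] (Fin r → ℝ) := LinearMap.pi fun j => (innerSL ℝ (w j) : Vec N →ₗ[ℝ] ℝ)
  have hA : Function.Surjective A := by
    intro y
    have hdet : IsUnit (Matrix.gram ℝ w).det :=
      (Matrix.posDef_gram_of_linearIndependent (𝕜 := ℝ) hw).det_pos.ne'.isUnit
    -- On combinations of the `w i`, `A` acts on coefficients as the Gram matrix, which is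
    -- invertible.
    refine ⟨∑ i, ((Matrix.gram ℝ w)⁻¹.mulVec y) i • w i, ?_⟩
    have h : (Matrix.gram ℝ w).mulVec ((Matrix.gram ℝ w)⁻¹.mulVec y) = y := by
      rw [Matrix.mulVec_mulVec, Matrix.mul_nonsing_inv _ hdet, Matrix.one_mulVec]
    conv_rhs => rw [← h]
    ext j
    simp only [A, LinearMap.pi_apply, ContinuousLinearMap.coe_coe, innerSL_apply_apply, inner_sum,
      real_inner_smul_right, Matrix.mulVec, dotProduct, Matrix.gram_apply]
    exact Finset.sum_congr rfl fun i _ => mul_comm _ _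
  filter_upwards [ae_linearIndependent_comp A hA le_rfl] with g hg hgi c hc
  rw [Grassmannian.proj_eq_zero_iff] at hc
  have hspan : Submodule.span ℝ (Set.range fun i => A (g i)) = ⊤ :=
    hg.span_eq_top_of_card_eq_finrank' (by simp)
  have hort : ∀ y : Fin r → ℝ, c.ofLp ⬝ᵥ y = 0 := by
    intro y
    have hy : y ∈ Submodule.span ℝ (Set.range fun i => A (g i)) := hspan ▸ Submodule.mem_top
    induction hy using Submodule.span_induction with
    | mem x hx =>
      obtain ⟨i, rfl⟩ := hx
      have hgm : g i ∈ (Frame.span ⟨g, hgi⟩).1 := Submodule.subset_span ⟨i, rfl⟩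
      have := Submodule.inner_left_of_mem_orthogonal hgm hc
      simpa [A, dotProduct, sum_inner, real_inner_smul_left] using this
    | zero => simp
    | add x y _ _ hx hy => rw [dotProduct_add, hx, hy, add_zero]
    | smul a x _ hx => rw [dotProduct_smul, hx, smul_zero]
  have := dotProduct_self_eq_zero.1 (hort c.ofLp)
  ext i
  simp [this]

/-- Since `m < r ≤ N`, a shorter family can be lengthened by an independent vector, which is then
given coefficient `0`. -/
theorem ae_transversal (hrN : r ≤ N) {m : ℕ} (hm : m ≤ r) {w : Fin m → Vec N}
    (hw : LinearIndependent ℝ w) : ∀ᵐ W ∂uniformGrassmannian N r, Transversal w W := by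
  induction hm using Nat.decreasingInduction with
  | self => exact ae_transversal_of_eq hw
  | of_succ m hm ih =>
    obtain ⟨x, hx⟩ := exists_linearIndependent_cons_of_lt_finrank hw
      (by rw [finrank_euclideanSpace_fin]; omega)
    filter_upwards [ih hx] with W hW c hc
    have h := hW (WithLp.toLp 2 (Fin.cons 0 c.ofLp)) (by simpa [Fin.sum_univ_succ] using hc)
    ext i
    simpa using congrArg (fun d : Vec (m + 1) => d i.succ) h

theorem ae_proj_ne_zero (hr : 1 ≤ r) (hrN : r ≤ N) {v : Vec N} (hv : v ≠ 0) :
    ∀ᵐ W ∂uniformGrassmannian N r, W.proj v ≠ 0 := by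
  have hli : LinearIndependent ℝ fun _ : Fin 1 => v := linearIndependent_unique_iff.2 hv
  filter_upwards [ae_transversal hrN hr hli] with W hW h
  have := hW (WithLp.toLp 2 fun _ => 1) (by simpa using h)
  simpa using congrArg (fun d : Vec 1 => d 0) this

/-- More than `r` vectors have a nontrivial combination orthogonal to the `r`-dimensional `V`. It is
chosen from `w` and `V` alone, so it is a fixed nonzero vector as far as `W` is concerned. -/
theorem ae_distinguishes (hr : 1 ≤ r) (hrN : r ≤ N) {m : ℕ} (hm : r < m) {w : Fin m → Vec N}
    (hw : LinearIndependent ℝ w) (V : Grassmannian N r) :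
    ∀ᵐ W ∂uniformGrassmannian N r, Distinguishes w V W := by
  let f : (Fin m → ℝ) →ₗ[ℝ] V.1 :=
    (V.1.orthogonalProjectionOnto : Vec N →ₗ[ℝ] V.1) ∘ₗ Fintype.linearCombination ℝ w
  have hker : LinearMap.ker f ≠ ⊥ := LinearMap.ker_ne_bot_of_finrank_lt (by
    rw [V.2, Module.finrank_fin_fun]; exact hm)
  obtain ⟨c, hc, hc0⟩ := (Submodule.ne_bot_iff _).1 hker
  have hv : ∑ j, c j • w j ≠ 0 := fun h => hc0 (by
    ext j; exact Fintype.linearIndependent_iff.1 hw c h j)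
  filter_upwards [ae_proj_ne_zero hr hrN hv] with W hW
  refine ⟨WithLp.toLp 2 c, ?_, hW⟩
  have h : V.1.orthogonalProjectionOnto (∑ j, c j • w j) = 0 := by
    simpa [f, Fintype.linearCombination_apply] using hc
  change V.1.starProjection (∑ j, c j • w j) = 0
  rw [Submodule.starProjection_apply, h, Submodule.coe_zero]

/-! ### Random subspaces with a density, independent of the remaining data -/

/-- By independence the joint law is a product, so Fubini applies; `ν`-null sections are null for
the law of `T` because that law has a density. -/
theorem ae_of_indepFun_of_hasPDF {Ω E F : Type*} [MeasurableSpace Ω] [MeasurableSpace E]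
    [MeasurableSpace F] {μ : Measure Ω} [IsProbabilityMeasure μ] {ν : Measure F} {X : Ω → E}
    {T : Ω → F} (hX : Measurable X) (hT : Measurable T) (hpdf : HasPDF T μ ν)
    (hind : IndepFun X T μ) {A : Set (E × F)} (hA : MeasurableSet A)
    (h : ∀ᵐ ω ∂μ, ∀ᵐ W ∂ν, (X ω, W) ∈ A) : ∀ᵐ ω ∂μ, (X ω, T ω) ∈ A := by
  have : IsProbabilityMeasure (μ.map T) := Measure.isProbabilityMeasure_map hT.aemeasurable
  have hprod := (indepFun_iff_map_prod_eq_prod_map_map hX.aemeasurable hT.aemeasurable).1 hind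
  refine ae_of_ae_map (f := fun ω => (X ω, T ω)) (p := fun z => z ∈ A)
    (hX.prodMk hT).aemeasurable ?_
  rw [hprod, Measure.ae_prod_mem_iff_ae_ae_mem hA, ae_map_iff hX.aemeasurable]
  · filter_upwards [h] with ω hω
    exact hpdf.absolutelyContinuous'.ae_le hω
  · exact measurable_measure_prodMk_left hA.compl (measurableSet_singleton 0)

/-! ### Separation of classes in terms of the images of the covariance matrices -/

/-- The kernel of a symmetric operator is the orthogonal complement of its range; from here on only
the images matter. -/
theorem toEuclideanLin_eq_zero_iff_proj_eq_zero {S : Matrix (Fin N) (Fin N) ℝ}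
    (hS : S.PosSemidef) {W : Grassmannian N r} (hW : W.1 = image S) (v : Vec N) :
    Matrix.toEuclideanLin S v = 0 ↔ W.proj v = 0 := by
  have hsymm : (Matrix.toEuclideanLin S).IsSymmetric :=
    Matrix.isSymmetric_toEuclideanLin_iff.2 hS.1
  rw [Grassmannian.proj_eq_zero_iff, hW, image, hsymm.orthogonal_range, LinearMap.mem_ker]

theorem toEuclideanLin_transpose_apply (Φ : Matrix (Fin M) (Fin N) ℝ) (c : Vec M) :
    Matrix.toEuclideanLin Φ.transpose c = ∑ m, c m • WithLp.toLp 2 (Φ m) := by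
  ext j
  simp [Matrix.toLpLin_apply, Matrix.mulVec, dotProduct, mul_comm]

theorem exists_separates_of_distinguishes {S T : Matrix (Fin N) (Fin N) ℝ} (hS : S.PosSemidef)
    (hT : T.PosSemidef) {V W : Grassmannian N r} (hV : V.1 = image T) (hW : W.1 = image S)
    {Φ : Matrix (Fin M) (Fin N) ℝ} (h : Distinguishes (fun m => WithLp.toLp 2 (Φ m)) V W) :
    ∃ c, Separates Φ S T c := by
  obtain ⟨c, hcV, hcW⟩ := h
  refine ⟨c, ?_, ?_⟩
  · rwa [toEuclideanLin_transpose_apply, Ne, toEuclideanLin_eq_zero_iff_proj_eq_zero hS hW]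
  · rwa [toEuclideanLin_transpose_apply, toEuclideanLin_eq_zero_iff_proj_eq_zero hT hV]

theorem distinguishes_of_mem {m : ℕ} {w : Fin m → Vec N} {V W : Grassmannian N r} (a : Fin m)
    (hV : V.proj (w a) = 0) (hW : W.proj (w a) ≠ 0) : Distinguishes w V W :=
  ⟨EuclideanSpace.single a 1, by simpa [Pi.single_apply] using hV,
    by simpa [Pi.single_apply] using hW⟩

theorem lowNoisePhaseTransition_of_distinguishes {p : Fin L → ℝ}
    (hp : p ∈ stdSimplex ℝ (Fin L)) {S : Fin L → Matrix (Fin N) (Fin N) ℝ}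
    (hS : ∀ i, (S i).PosSemidef) {R : Fin L → Grassmannian N r} (hR : ∀ i, (R i).1 = image (S i))
    {Φ : Matrix (Fin M) (Fin N) ℝ}
    (h : ∀ i j, i ≠ j → Distinguishes (fun m => WithLp.toLp 2 (Φ m)) (R i) (R j) ∨
      Distinguishes (fun m => WithLp.toLp 2 (Φ m)) (R j) (R i)) :
    LowNoisePhaseTransition p S Φ :=
  lowNoisePhaseTransition_of_separates hp hS fun i j hij => (h i j hij).symm.imp
    (exists_separates_of_distinguishes (hS i) (hS j) (hR j) (hR i))
    (exists_separates_of_distinguishes (hS j) (hS i) (hR i) (hR j))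

/-- If each `R i` for `i ∈ range σ` has a row orthogonal to it and to no other `R j`, two classes
are distinguished as soon as one of them lies in the range of `σ`. -/
theorem distinguishes_or_of_mem_range {m : ℕ} {w : Fin m → Vec N} {R : Fin L → Grassmannian N r}
    {σ : Fin m → Fin L} (hself : ∀ a, (R (σ a)).proj (w a) = 0)
    (hother : ∀ a j, j ≠ σ a → (R j).proj (w a) ≠ 0) {i j : Fin L} (hij : i ≠ j)
    (h : i ∈ Set.range σ ∨ j ∈ Set.range σ) :
    Distinguishes w (R i) (R j) ∨ Distinguishes w (R j) (R i) := by
  rcases h with ⟨a, rfl⟩ | ⟨a, rfl⟩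
  · exact Or.inl (distinguishes_of_mem a (hself a) (hother a j hij.symm))
  · exact Or.inr (distinguishes_of_mem a (hself a) (hother a i hij))

/-! ### Almost sure separation -/

section Random

variable {Ω : Type*} [MeasurableSpace Ω] {μ : Measure Ω}

/-- A function of the data of the classes in `s` is independent of the image of a class outside
of `s`. -/
theorem indepFun_of_notMem {d : ℕ} {R : Fin L → Ω → Grassmannian N r}
    {B : Fin L → Ω → Fin d → Vec N} (hR : ∀ i, Measurable (R i))
    (hB : ∀ i, Measurable (B i)) (hind : iIndepFun (fun i ω => (R i ω, B i ω)) μ)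
    {s : Finset (Fin L)} {j : Fin L} (hj : j ∉ s) {E : Type*} [MeasurableSpace E]
    {φ : (s → Grassmannian N r × (Fin d → Vec N)) → E} (hφ : Measurable φ) :
    IndepFun (fun ω => φ fun i => (R i ω, B i ω)) (R j) μ := by
  have h := hind.indepFun_finset s {j} (Finset.disjoint_singleton_right.2 hj)
    fun i => (hR i).prodMk (hB i)
  exact h.comp hφ (ψ := fun z => (z ⟨j, Finset.mem_singleton_self j⟩).1) (by fun_prop)

variable [IsProbabilityMeasure μ]

theorem ae_proj_ne_zero_of_indepFun (hr : 1 ≤ r) (hrN : r ≤ N) {X : Ω → Vec N}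
    (hX : Measurable X) (hX0 : ∀ ω, X ω ≠ 0) {R : Ω → Grassmannian N r} (hR : Measurable R)
    (hRpdf : HasPDF R μ (uniformGrassmannian N r)) (hind : IndepFun X R μ) :
    ∀ᵐ ω ∂μ, (R ω).proj (X ω) ≠ 0 := by
  have hA : MeasurableSet {z : Vec N × Grassmannian N r | z.2.proj z.1 ≠ 0} :=
    (isClosed_eq (continuous_proj_apply continuous_snd continuous_fst)
      continuous_const).measurableSet.compl
  exact ae_of_indepFun_of_hasPDF hX hR hRpdf hind hA
    (Eventually.of_forall fun ω => ae_proj_ne_zero hr hrN (hX0 ω))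

theorem ae_transversal_of_indepFun (hrN : r ≤ N) {m : ℕ} (hm : m ≤ r) {X : Ω → Fin m → Vec N}
    (hX : Measurable X) (hXli : ∀ᵐ ω ∂μ, LinearIndependent ℝ (X ω)) {R : Ω → Grassmannian N r}
    (hR : Measurable R) (hRpdf : HasPDF R μ (uniformGrassmannian N r)) (hind : IndepFun X R μ) :
    ∀ᵐ ω ∂μ, Transversal (X ω) (R ω) :=
  ae_of_indepFun_of_hasPDF hX hR hRpdf hind measurableSet_transversal
    (hXli.mono fun _ hω => ae_transversal hrN hm hω)

theorem ae_distinguishes_of_indepFun (hr : 1 ≤ r) (hrN : r ≤ N) {m : ℕ} (hm : r < m)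
    {X : Ω → Fin m → Vec N} {V R : Ω → Grassmannian N r} (hX : Measurable X) (hV : Measurable V)
    (hXli : ∀ᵐ ω ∂μ, LinearIndependent ℝ (X ω)) (hR : Measurable R)
    (hRpdf : HasPDF R μ (uniformGrassmannian N r))
    (hind : IndepFun (fun ω => (X ω, V ω)) R μ) :
    ∀ᵐ ω ∂μ, Distinguishes (X ω) (V ω) (R ω) :=
  ae_of_indepFun_of_hasPDF (hX.prodMk hV) hR hRpdf hind measurableSet_distinguishes
    (hXli.mono fun ω hω => ae_distinguishes hr hrN hm hω (V ω))

theorem ae_distinguishes_const (hr : 1 ≤ r) (hrN : r ≤ N) {m : ℕ} (hm : r < m)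
    {w : Fin m → Vec N} (hw : LinearIndependent ℝ w) {R : Fin L → Ω → Grassmannian N r}
    (hR : ∀ i, Measurable (R i)) (hRpdf : ∀ i, HasPDF (R i) μ (uniformGrassmannian N r))
    (hRind : iIndepFun R μ) :
    ∀ᵐ ω ∂μ, ∀ i j, i ≠ j → Distinguishes w (R i ω) (R j ω) := by
  simp only [ae_all_iff]
  intro i j hij
  refine ae_distinguishes_of_indepFun (X := fun _ => w) hr hrN hm measurable_const (hR i)
    (Eventually.of_forall fun _ => hw) (hR j) (hRpdf j) ?_
  exact (hRind.indepFun hij).comp (φ := fun V => (w, V)) (ψ := id) (by fun_prop) measurable_id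

variable {d : ℕ} {R : Fin L → Ω → Grassmannian N r} {B : Fin L → Ω → Fin d → Vec N}

/-- Rows are added one at a time. The previous ones, at most `r` in number, are independent of the
next image and so almost surely transversal to it: no nonzero vector of their span is orthogonal to
that image, whereas the new row is. -/
theorem ae_linearIndependent_rows (hrN : r ≤ N) (hR : ∀ i, Measurable (R i))
    (hRpdf : ∀ i, HasPDF (R i) μ (uniformGrassmannian N r)) (hB : ∀ i, Measurable (B i))
    (hind : iIndepFun (fun i ω => (R i ω, B i ω)) μ) (hB0 : ∀ i ω k, B i ω k ≠ 0)
    (hBR : ∀ i ω k, (R i ω).proj (B i ω k) = 0) {m : ℕ} (hm : m ≤ r + 1) {σ : Fin m → Fin L}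
    (hσ : Function.Injective σ) (k : Fin m → Fin d) :
    ∀ᵐ ω ∂μ, LinearIndependent ℝ fun a => B (σ a) ω (k a) := by
  induction m with
  | zero => exact Eventually.of_forall fun ω => linearIndependent_empty_type
  | succ m ih =>
    have hli := ih (by omega) (σ := σ ∘ Fin.castSucc)
      (hσ.comp (Fin.castSucc_injective m)) (k ∘ Fin.castSucc)
    have hX : Measurable fun ω (a : Fin m) => B (σ a.castSucc) ω (k a.castSucc) :=
      measurable_pi_lambda _ fun a => (measurable_pi_apply _).comp (hB _)
    have hlast : σ (Fin.last m) ∉ Finset.univ.image (σ ∘ Fin.castSucc) := by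
      simp only [Finset.mem_image, Finset.mem_univ, true_and, not_exists]
      exact fun a ha => (Fin.castSucc_lt_last a).ne (hσ ha)
    have hmem : ∀ a : Fin m, σ a.castSucc ∈ Finset.univ.image (σ ∘ Fin.castSucc) := fun a =>
      Finset.mem_image_of_mem _ (Finset.mem_univ a)
    have hindep := indepFun_of_notMem hR hB hind hlast
      (φ := fun z a => (z ⟨σ (Fin.castSucc a), hmem a⟩).2 (k a.castSucc)) (by fun_prop)
    filter_upwards [hli, ae_transversal_of_indepFun hrN (by omega) hX hli (hR _) (hRpdf _) hindep]
      with ω hω htr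
    have hsnoc : (fun a => B (σ a) ω (k a)) = Fin.snoc
        (fun a : Fin m => B (σ a.castSucc) ω (k a.castSucc))
        (B (σ (Fin.last m)) ω (k (Fin.last m))) := by
      ext1 a
      refine Fin.lastCases ?_ (fun a => ?_) a <;> simp
    rw [hsnoc, linearIndependent_finSnoc]
    refine ⟨hω, fun hspan => ?_⟩
    obtain ⟨c, hc⟩ := (Submodule.mem_span_range_iff_exists_fun ℝ).1 hspan
    have hc0 := htr (WithLp.toLp 2 c) (by simpa only [hc] using hBR _ ω _)
    refine hB0 (σ (Fin.last m)) ω (k (Fin.last m)) ?_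
    rw [← hc]
    refine Finset.sum_eq_zero fun a _ => ?_
    have := congrArg (fun v : Vec m => v a) hc0
    simp only [PiLp.zero_apply] at this
    rw [this, zero_smul]

theorem ae_distinguishes_rows (hr : 1 ≤ r) (hrN : r ≤ N) (hR : ∀ i, Measurable (R i))
    (hRpdf : ∀ i, HasPDF (R i) μ (uniformGrassmannian N r)) (hB : ∀ i, Measurable (B i))
    (hind : iIndepFun (fun i ω => (R i ω, B i ω)) μ) (hB0 : ∀ i ω k, B i ω k ≠ 0)
    (hBR : ∀ i ω k, (R i ω).proj (B i ω k) = 0) {m : ℕ} (hm : m = min (L - 1) (r + 1))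
    {σ : Fin m → Fin L} (hσ : Function.Injective σ) (k : Fin m → Fin d) :
    ∀ᵐ ω ∂μ, ∀ i j, i ≠ j →
      Distinguishes (fun a => B (σ a) ω (k a)) (R i ω) (R j ω) ∨
        Distinguishes (fun a => B (σ a) ω (k a)) (R j ω) (R i ω) := by
  have hother : ∀ᵐ ω ∂μ, ∀ a j, j ≠ σ a → (R j ω).proj (B (σ a) ω (k a)) ≠ 0 := by
    simp only [ae_all_iff]
    intro a j hj
    refine ae_proj_ne_zero_of_indepFun (X := fun ω => B (σ a) ω (k a)) hr hrN
      ((measurable_pi_apply _).comp (hB _))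
      (fun ω => hB0 _ ω _) (hR j) (hRpdf j) ?_
    exact indepFun_of_notMem hR hB hind (s := {σ a}) (by simpa using hj)
      (φ := fun z => (z ⟨σ a, Finset.mem_singleton_self _⟩).2 (k a)) (by fun_prop)
  have hrest : ∀ᵐ ω ∂μ, ∀ i j, i ≠ j → i ∉ Set.range σ → j ∉ Set.range σ →
      Distinguishes (fun a => B (σ a) ω (k a)) (R i ω) (R j ω) := by
    simp only [ae_all_iff]
    intro i j hij hi hj
    have hcard : m + 2 ≤ L := by
      have h1 : (insert i (insert j (Finset.univ.image σ))).card = m + 2 := by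
        rw [Finset.card_insert_of_notMem, Finset.card_insert_of_notMem,
          Finset.card_image_of_injective _ hσ, Finset.card_fin]
        · simpa using hj
        · simpa [hij] using hi
      simpa [h1] using Finset.card_le_univ (insert i (insert j (Finset.univ.image σ)))
    -- Two classes without a row exclude `m = L - 1`, so the minimum is `r + 1` and the dimension
    -- count applies.
    have hmr : m = r + 1 := by omega
    refine ae_distinguishes_of_indepFun (X := fun ω a => B (σ a) ω (k a)) hr hrN (by omega)
      (measurable_pi_lambda _ fun a => (measurable_pi_apply _).comp (hB _)) (hR i)
      (ae_linearIndependent_rows hrN hR hRpdf hB hind hB0 hBR hmr.le hσ k) (hR j) (hRpdf j) ?_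
    have hmem : ∀ a, σ a ∈ insert i (Finset.univ.image σ) := fun a =>
      Finset.mem_insert_of_mem (Finset.mem_image_of_mem _ (Finset.mem_univ a))
    exact indepFun_of_notMem hR hB hind (s := insert i (Finset.univ.image σ))
      (by simpa [hij.symm] using hj)
      (φ := fun z => (fun a => (z ⟨σ a, hmem a⟩).2 (k a), (z ⟨i, Finset.mem_insert_self _ _⟩).1))
      (by fun_prop)
  filter_upwards [hother, hrest] with ω h1 h2 i j hij
  by_cases h : i ∈ Set.range σ ∨ j ∈ Set.range σ
  · exact distinguishes_or_of_mem_range (R := fun i => R i ω) (fun a => hBR _ ω _) h1 hij h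
  · rw [not_or] at h
    exact Or.inl (h2 i j hij h.1 h.2)

end Random

/-! ### A design with one measurement per class -/

theorem exists_mem_orthogonal_forall_proj_ne_zero {R : Fin L → Grassmannian N r}
    (h : ∀ i j, i ≠ j → ∃ v, (R i).proj v = 0 ∧ (R j).proj v ≠ 0) (i : Fin L) :
    ∃ v, (R i).proj v = 0 ∧ ∀ j, j ≠ i → (R j).proj v ≠ 0 := by
  -- A real vector space is not a finite union of proper subspaces; here the space is `(R i)ᗮ` and
  -- the subspaces are its intersections with the other `(R j)ᗮ`.
  obtain ⟨x, hx⟩ := Submodule.exists_forall_notMem_of_forall_ne_top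
    (fun j : {j // j ≠ i} => ((R j).1ᗮ).comap ((R i).1ᗮ).subtype) fun j htop => by
      obtain ⟨v, hvi, hvj⟩ := h i j j.2.symm
      rw [Grassmannian.proj_eq_zero_iff] at hvi
      rw [Ne, Grassmannian.proj_eq_zero_iff] at hvj
      have : (⟨v, hvi⟩ : ((R i).1ᗮ : Submodule ℝ (Vec N))) ∈
        ((R j).1ᗮ).comap ((R i).1ᗮ).subtype := htop ▸ Submodule.mem_top
      exact hvj this
  refine ⟨x, (Grassmannian.proj_eq_zero_iff _ _).2 x.2, fun j hj hz => ?_⟩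
  exact hx ⟨j, hj⟩ ((Grassmannian.proj_eq_zero_iff _ _).1 hz)

theorem exists_design_of_sub_one_le {p : Fin L → ℝ} (hp : p ∈ stdSimplex ℝ (Fin L))
    {S : Fin L → Matrix (Fin N) (Fin N) ℝ} (hS : ∀ i, (S i).PosSemidef)
    {R : Fin L → Grassmannian N r} (hR : ∀ i, (R i).1 = image (S i))
    (h : ∀ i j, i ≠ j → ∃ v, (R i).proj v = 0 ∧ (R j).proj v ≠ 0) (hML : M ≤ L)
    (hLM : L ≤ M + 1) :
    ∃ Φ : Matrix (Fin M) (Fin N) ℝ, LowNoisePhaseTransition p S Φ := by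
  choose n hself hother using exists_mem_orthogonal_forall_proj_ne_zero h
  refine ⟨Matrix.of fun m => (n (Fin.castLE hML m)).ofLp,
    lowNoisePhaseTransition_of_distinguishes hp hS hR fun i j hij => ?_⟩
  refine distinguishes_or_of_mem_range (σ := Fin.castLE hML) (fun a => hself _)
    (fun a j hj => hother _ j hj) hij ?_
  -- At most one class, of index `M`, has no row, so two distinct classes cannot both lack one.
  by_cases hi : (i : ℕ) < M
  · exact Or.inl ⟨⟨i, hi⟩, rfl⟩
  · have hj : (j : ℕ) < M := by
      have := Fin.val_ne_of_ne hij
      omega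
    exact Or.inr ⟨⟨j, hj⟩, rfl⟩

end SubspaceClassification

end

open SubspaceClassification in
theorem proposition5 {Ω : Type*} [MeasurableSpace Ω] (μ : Measure Ω) [IsProbabilityMeasure μ]
    {N L r : ℕ} (hr : 1 ≤ r) (hrN : r < N)
    -- the prior probabilities of the classes
    (p : Fin L → ℝ) (hp : p ∈ stdSimplex ℝ (Fin L))
    -- the (random) class covariance matrices and their images, which are `r`-dimensional
    (S : Fin L → Ω → Matrix (Fin N) (Fin N) ℝ) (hS : ∀ i ω, (S i ω).PosSemidef)
    (R : Fin L → Ω → Grassmannian N r) (hRS : ∀ i ω, (R i ω).1 = image (S i ω))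
    -- the images are independent and have densities on the Grassmann manifold
    (hR : ∀ i, Measurable (R i)) (hRpdf : ∀ i, HasPDF (R i) μ (uniformGrassmannian N r))
    (hRind : iIndepFun R μ) :
    -- `min {L - 1, r + 1}` designed measurements suffice, with probability one
    (∀ᵐ ω ∂μ, ∃ Φ : Matrix (Fin (min (L - 1) (r + 1))) (Fin N) ℝ,
      LowNoisePhaseTransition p (fun i => S i ω) Φ) ∧
    -- for bases `B i` of the null spaces, chosen independently for the different classes, every
    -- one-vs-all matrix built from them is such a design, with probability one
    (∀ B : Fin L → Ω → Fin (N - r) → Vec N, (∀ i, Measurable (B i)) →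
      (∀ i ω, LinearIndependent ℝ (B i ω) ∧
        Submodule.span ℝ (Set.range (B i ω)) = nullSpace (S i ω)) →
      iIndepFun (fun i ω => (R i ω, B i ω)) μ →
      ∀ᵐ ω ∂μ, ∀ (π : Equiv.Perm (Fin L)) (k : Fin (min (L - 1) (r + 1)) → Fin (N - r)),
        LowNoisePhaseTransition p (fun i => S i ω)
          (oneVsAllMatrix ((min_le_left _ _).trans (Nat.sub_le L 1)) (fun i => B i ω) π k)) := by
  refine ⟨?_, fun B hB hbasis hind => ?_⟩
  · by_cases hL : L ≤ min (L - 1) (r + 1) + 1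
    -- The case of `L - 1` rows. Combinations of the full basis are arbitrary vectors, and its `N >
    -- r` elements yield, for each ordered pair, a vector orthogonal to the first image and not to
    -- the second.
    · have hli : LinearIndependent ℝ (EuclideanSpace.basisFun (Fin N) ℝ) :=
        (EuclideanSpace.basisFun (Fin N) ℝ).orthonormal.linearIndependent
      filter_upwards [ae_distinguishes_const hr hrN.le hrN hli hR hRpdf hRind] with ω hω
      exact exists_design_of_sub_one_le hp (fun i => hS i ω) (fun i => hRS i ω)
        (fun i j hij => let ⟨_, hc⟩ := hω i j hij; ⟨_, hc⟩)
        ((min_le_left _ _).trans (Nat.sub_le L 1)) hL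
    · have hM : min (L - 1) (r + 1) = r + 1 := by omega
      -- For `r + 1 ≤ N` measurements a fixed design suffices: the first `r + 1` coordinate vectors.
      have hli : LinearIndependent ℝ fun a : Fin (min (L - 1) (r + 1)) =>
          EuclideanSpace.basisFun (Fin N) ℝ (Fin.castLE (by omega) a) :=
        (EuclideanSpace.basisFun (Fin N) ℝ).orthonormal.linearIndependent.comp _
          (Fin.castLE_injective _)
      filter_upwards [ae_distinguishes_const hr hrN.le (by omega) hli hR hRpdf hRind] with ω hω
      exact ⟨Matrix.of fun a => (EuclideanSpace.basisFun (Fin N) ℝ (Fin.castLE (by omega) a)).ofLp,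
        lowNoisePhaseTransition_of_distinguishes hp (fun i => hS i ω) (fun i => hRS i ω)
          fun i j hij => Or.inl (hω i j hij)⟩
  · have hB0 : ∀ i ω k, B i ω k ≠ 0 := fun i ω k => (hbasis i ω).1.ne_zero k
    have hBR : ∀ i ω k, (R i ω).proj (B i ω k) = 0 := fun i ω k => by
      rw [← toEuclideanLin_eq_zero_iff_proj_eq_zero (hS i ω) (hRS i ω), ← LinearMap.mem_ker,
        ← nullSpace, ← (hbasis i ω).2]
      exact Submodule.subset_span ⟨k, rfl⟩
    simp only [ae_all_iff]
    intro π k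
    filter_upwards [ae_distinguishes_rows hr hrN.le hR hRpdf hB hind hB0 hBR rfl
      (σ := fun a => π (Fin.castLE ((min_le_left _ _).trans (Nat.sub_le L 1)) a))
      (π.injective.comp (Fin.castLE_injective _)) k] with ω hω
    exact lowNoisePhaseTransition_of_distinguishes hp (fun i => hS i ω) (fun i => hRS i ω) hω
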